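/- All regular spaces are assumed to be $T_1$. A space is countably compact if each of its countable open covers has a finite subcover; it is totally countably compact if each infinite subset of it contains an infinite subset whose closure is compact. A regular space is $\mathbb{R}$-rigid if every continuous real-valued function on it is constant. (1) Every separable, regular, non-normal, countably compact space $X$ embeds (homeomorphically onto a subspace) into a regular, separable, countably compact, $\mathbb{R}$-rigid space $R(X)$. (2) Every separable, regular, non-normal, totally countably compact space $X$ embeds into a regular, separable, totally countably compact, $\mathbb{R}$-rigid space $R(X)$. (3) Consequently there exists (in ZFC) a regular, separable, totally countably compact (and hence countably compact) $\mathbb{R}$-rigid space with more than one point. -/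

import Mathlib

/-- A space is totally countably compact if each infinite subset contains an infinite subset
whose closure is compact. -/
def TotallyCountablyCompact (X : Type*) [TopologicalSpace X] : Prop :=
  ∀ A : Set X, A.Infinite → ∃ B : Set X, B ⊆ A ∧ B.Infinite ∧ IsCompact (closure B)

/-- A regular (that is, `T₃`) space is `ℝ`-rigid if every continuous real-valued function on it
is constant. -/
def RRigid (X : Type*) [TopologicalSpace X] : Prop :=
  T3Space X ∧ ∀ f : X → ℝ, Continuous f → ∀ x y : X, f x = f y

universe u

/-! The construction needs a regular, separable, totally countably compact space `Z` with points `a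
≠ b` at which all continuous real functions agree. Given `X`, take the product `X × Z × Z × …` and
let a sequence forget its `i`-th term when the later terms are `b, a, a, …`. In the quotient, a
continuous function does not notice a term `a` turning into `b`, and once that has happened the
preceding term may be changed freely. Undoing the turn, one can replace the terms of an
eventually-`a` sequence one at a time (`Rigidification.rRigid`); such sequences are dense, so the
function is constant. `X` sits inside as the sequences `x, a, a, …`. Regularity survives because
forgetting a term fixes all later ones (`separates_remembered`), and the compactness properties pass
to countable products and continuous images.

To get `Z`, remove from the ultrafilters on `α × α` a point at which two disjoint closed sets, the
edge and the side, both accumulate. Every continuous real function has an extended real limit there.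
Glue `ℤ` many copies alternately along edge and side and add two end points: the limits on all
levels coincide, so the ends have equal values (`Corkscrew.apply_top_eq_apply_bot`). -/

section

open Filter Topology Set TopologicalSpace

/-! ### Compactness of sequences, products and images -/

/-- Every sequence has a subsequence contained in a compact set. -/
def SubseqCompact (X : Type*) [TopologicalSpace X] : Prop :=
  ∀ t : ℕ → X, ∃ φ : ℕ → ℕ, StrictMono φ ∧ ∃ K : Set X, IsCompact K ∧ ∀ n, t (φ n) ∈ K

theorem TotallyCountablyCompact.subseqCompact {X : Type*} [TopologicalSpace X]
    (h : TotallyCountablyCompact X) : SubseqCompact X := by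
  intro t
  by_cases hfin : (range t).Finite
  · have : ∃ x ∈ range t, ∃ᶠ n in atTop, t n = x := by
      by_contra! hcon
      have h1 : ∀ᶠ n in atTop, ∀ x ∈ range t, t n ≠ x :=
        (eventually_all_finite hfin).2 fun x hx => by simpa using hcon x hx
      obtain ⟨n, hn⟩ := h1.exists
      exact hn (t n) ⟨n, rfl⟩ rfl
    obtain ⟨x, -, hx⟩ := this
    obtain ⟨φ, hφ, h'⟩ := extraction_of_frequently_atTop hx
    exact ⟨φ, hφ, {x}, isCompact_singleton, fun n => h' n⟩
  · obtain ⟨B, hB, hBi, hK⟩ := h _ hfin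
    have hfreq : ∃ᶠ n in atTop, t n ∈ B := by
      rw [Nat.frequently_atTop_iff_infinite]
      intro hf
      refine hBi ((hf.image t).subset ?_)
      intro x hx
      obtain ⟨n, rfl⟩ := hB hx
      exact ⟨n, hx, rfl⟩
    obtain ⟨φ, hφ, h'⟩ := extraction_of_frequently_atTop hfreq
    exact ⟨φ, hφ, _, hK, fun n => subset_closure (h' n)⟩

theorem SubseqCompact.totallyCountablyCompact {X : Type*} [TopologicalSpace X] [R1Space X]
    (h : SubseqCompact X) : TotallyCountablyCompact X := by
  intro A hA
  obtain ⟨φ, hφ, K, hK, hmem⟩ := h fun n => (hA.natEmbedding A n : X)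
  refine ⟨range fun n => (hA.natEmbedding A (φ n) : X), ?_, ?_, ?_⟩
  · rintro _ ⟨n, rfl⟩
    exact Subtype.coe_prop _
  · refine infinite_range_of_injective fun m n hmn => hφ.injective ?_
    exact (hA.natEmbedding A).injective (Subtype.ext hmn)
  · exact hK.closure_of_subset (range_subset_iff.2 hmem)

theorem SubseqCompact.of_surjective {X Y : Type*} [TopologicalSpace X] [TopologicalSpace Y]
    (h : SubseqCompact X) {g : X → Y} (hg : Continuous g) (hs : g.Surjective) :
    SubseqCompact Y := by
  intro t
  choose s hs using fun n => hs (t n)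
  obtain ⟨φ, hφ, K, hK, hmem⟩ := h s
  exact ⟨φ, hφ, g '' K, hK.image hg, fun n => ⟨_, hmem n, hs _⟩⟩

theorem SubseqCompact.pi {Y : ℕ → Type*} [∀ i, TopologicalSpace (Y i)]
    (h : ∀ i, SubseqCompact (Y i)) : SubseqCompact (∀ i, Y i) := by
  intro t
  -- `F i ψ` thins `ψ` to put coordinate `i` in a compact set. Choosing it for every `ψ` at once
  -- lets `Φ` be defined by recursion.
  choose F hF K hK hmem using fun (i : ℕ) (ψ : ℕ → ℕ) => h i fun n => t (ψ n) i
  let Φ : ℕ → ℕ → ℕ := fun i => Nat.rec (F 0 id) (fun i ψ => ψ ∘ F (i + 1) ψ) i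
  have hΦ : ∀ i, StrictMono (Φ i) := fun i => by
    induction i with
    | zero => exact hF 0 id
    | succ i ih => exact ih.comp (hF (i + 1) (Φ i))
  have hrange : ∀ i k, ∃ ψ : ℕ → ℕ, Φ (i + k) = Φ i ∘ ψ := fun i k => by
    induction k with
    | zero => exact ⟨id, rfl⟩
    | succ k ih =>
      obtain ⟨ψ, hψ⟩ := ih
      refine ⟨ψ ∘ F (i + k + 1) (Φ (i + k)), ?_⟩
      rw [← Function.comp_assoc, ← hψ]
      rfl
  have hKΦ : ∀ i, ∃ L : Set (Y i), IsCompact L ∧ ∀ n, t (Φ i n) i ∈ L := by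
    intro i
    cases i with
    | zero => exact ⟨_, hK 0 id, hmem 0 id⟩
    | succ i => exact ⟨_, hK (i + 1) (Φ i), hmem (i + 1) (Φ i)⟩
  choose L hL hLmem using hKΦ
  -- The diagonal is a subsequence of `Φ i` only from index `i` on; the finitely many earlier values
  -- are added to `L i`.
  refine ⟨fun n => Φ n n, strictMono_nat_of_lt_succ fun n => ?_,
    Set.pi univ fun i => L i ∪ (fun n => t (Φ n n) i) '' Iio i,
    isCompact_univ_pi fun i => (hL i).union ((finite_Iio i).image _).isCompact, ?_⟩
  · change Φ n n < Φ n (F (n + 1) (Φ n) (n + 1))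
    exact hΦ n (lt_of_lt_of_le (Nat.lt_succ_self n) ((hF (n + 1) (Φ n)).le_apply))
  · intro n i _
    rcases lt_or_ge n i with hni | hni
    · exact Or.inr ⟨n, hni, rfl⟩
    · obtain ⟨k, rfl⟩ := Nat.exists_eq_add_of_le hni
      obtain ⟨ψ, hψ⟩ := hrange i k
      left
      change t (Φ (i + k) (i + k)) i ∈ L i
      rw [hψ]
      exact hLmem i _

/-- Along a subsequence whose second coordinates stay in a compact set, any ultrafilter making the
first coordinates converge makes the second ones converge too. -/
theorem CountablyCompactSpace.prod_subseqCompact {X T : Type*} [TopologicalSpace X]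
    [TopologicalSpace T] [CountablyCompactSpace X] (h : SubseqCompact T) :
    CountablyCompactSpace (X × T) := by
  refine ⟨IsCountablyCompact.of_seq_clusterPt fun s _ => ?_⟩
  obtain ⟨φ, hφ, K, hK, hmem⟩ := h fun n => (s n).2
  obtain ⟨x, -, hx⟩ := (CountablyCompactSpace.isCountablyCompact_univ (E := X)).seq_clusterPt
    (fun n => (s (φ n)).1) (Eventually.of_forall fun _ => mem_univ _)
  obtain ⟨u, hu, hux⟩ := mapClusterPt_iff_ultrafilter.1 hx
  obtain ⟨y, -, hy⟩ := hK.ultrafilter_le_nhds' (u.map fun n => (s (φ n)).2)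
    (Filter.Eventually.of_forall (f := (u : Filter ℕ)) hmem)
  refine ⟨(x, y), mem_univ _, ?_⟩
  refine MapClusterPt.of_comp hφ.tendsto_atTop ?_
  refine mapClusterPt_iff_ultrafilter.2 ⟨u, hu, ?_⟩
  exact hux.prodMk_nhds hy

theorem CountablyCompactSpace.of_surjective {X Y : Type*} [TopologicalSpace X]
    [TopologicalSpace Y] [CountablyCompactSpace X] {g : X → Y} (hg : Continuous g)
    (hs : g.Surjective) : CountablyCompactSpace Y := by
  refine ⟨?_⟩
  rw [← hs.range_eq, ← image_univ]
  exact (CountablyCompactSpace.isCountablyCompact_univ (E := X)).image hg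

theorem SubseqCompact.countablyCompactSpace {X : Type*} [TopologicalSpace X]
    (h : SubseqCompact X) : CountablyCompactSpace X :=
  have := CountablyCompactSpace.prod_subseqCompact (X := PUnit) h
  .of_surjective (X := PUnit × X) continuous_snd Prod.snd_surjective

theorem CountablyCompactSpace.pi_nat {Y : ℕ → Type*} [∀ i, TopologicalSpace (Y i)]
    [CountablyCompactSpace (Y 0)] (h : ∀ i, SubseqCompact (Y (i + 1))) :
    CountablyCompactSpace (∀ i, Y i) := by
  have := CountablyCompactSpace.prod_subseqCompact (X := Y 0) (SubseqCompact.pi h)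
  refine .of_surjective (X := Y 0 × ∀ i, Y (i + 1))
    (g := fun p i => Nat.casesOn (motive := Y) i p.1 p.2) (continuous_pi fun i => ?_) fun y =>
      ⟨(y 0, fun i => y (i + 1)), funext fun i => ?_⟩
  · cases i with
    | zero => exact continuous_fst
    | succ i => exact (continuous_apply i).comp continuous_snd
  · cases i <;> rfl

/-! ### Products with forgotten coordinates -/

/-- The product `∀ i, Y i`, to be equipped with the topology in which a point `v` only remembers
its coordinates in `J v`. -/
def ForgetPi {ι : Type*} {Y : ι → Type*} (_J : (∀ i, Y i) → Set ι) : Type _ := ∀ i, Y i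

namespace ForgetPi

variable {ι : Type*} {Y : ι → Type*} [∀ i, TopologicalSpace (Y i)] {J : (∀ i, Y i) → Set ι}

/-- The identity map from the product. -/
def ofPi (J : (∀ i, Y i) → Set ι) (v : ∀ i, Y i) : ForgetPi J := v

/-- The points that remember their `i`-th coordinate and have it in `U`. -/
def cylinder (J : (∀ i, Y i) → Set ι) (i : ι) (U : Set (Y i)) : Set (ForgetPi J) :=
  {v | i ∈ J v ∧ v i ∈ U}

/-- The cylinders over open sets. -/
def cylinders (J : (∀ i, Y i) → Set ι) : Set (Set (ForgetPi J)) :=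
  {s | ∃ i, ∃ U : Set (Y i), IsOpen U ∧ s = cylinder J i U}

instance : TopologicalSpace (ForgetPi J) :=
  generateFrom (cylinders J)

theorem isOpen_cylinder {i : ι} {U : Set (Y i)} (hU : IsOpen U) : IsOpen (cylinder J i U) :=
  isOpen_generateFrom_of_mem ⟨i, U, hU, rfl⟩

/-- Whenever `x` remembers `i`, this is witnessed by one remembered coordinate of `x`, which is
remembered by all points that forget `i`. -/
def Separates (J : (∀ i, Y i) → Set ι) : Prop :=
  ∀ x, ∀ i ∈ J x, ∃ j ∈ J x, ∃ V ∈ 𝓝 (x j), ∀ v, i ∉ J v → j ∈ J v ∧ v j ∉ V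

theorem inseparable {x y : ForgetPi J} (h : J x = J y) (hxy : ∀ i ∈ J x, x i = y i) :
    Inseparable x y := by
  have key : ∀ i (U : Set (Y i)), x ∈ cylinder J i U ↔ y ∈ cylinder J i U := fun i U => by
    constructor
    · rintro ⟨hi, hU⟩
      exact ⟨h ▸ hi, hxy i hi ▸ hU⟩
    · rintro ⟨hi, hU⟩
      have hi' : i ∈ J x := h ▸ hi
      exact ⟨hi', (hxy i hi').symm ▸ hU⟩
  rw [Inseparable, nhds_generateFrom, nhds_generateFrom]
  congr! 4 with s
  ext s
  refine and_congr_left ?_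
  rintro ⟨i, U, -, rfl⟩
  exact key i U

theorem continuous_ofPi (hJ : Separates J) :
    Continuous (ofPi J) := by
  refine (continuous_generateFrom_iff (b := cylinders J)).2 fun s hs => ?_
  obtain ⟨i, U, hU, rfl⟩ := hs
  refine IsOpen.inter (s := {v : ∀ i, Y i | i ∈ J v}) ?_ (hU.preimage (continuous_apply i))
  refine isOpen_iff_mem_nhds.2 fun x hx => ?_
  obtain ⟨j, -, V, hV, h⟩ := hJ x i hx
  filter_upwards [(continuous_apply j).continuousAt.preimage_mem_nhds hV] with v hv
  by_contra hi
  exact (h v hi).2 hv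

/-- The closed condition "`v i ∈ K` if `i` is remembered" also admits all points that forget `i`.
The analogous condition at the witness `j` excludes them, since they remember `j` with a value
outside `V`. -/
theorem regularSpace [∀ i, RegularSpace (Y i)] (hJ : Separates J) :
    RegularSpace (ForgetPi J) := by
  have closed : ∀ (i : ι) (K : Set (Y i)), IsClosed K →
      IsClosed {v : ForgetPi J | i ∈ J v → v i ∈ K} := fun i K hK => by
    rw [← isOpen_compl_iff]
    convert isOpen_cylinder (J := J) (i := i) hK.isOpen_compl using 1
    ext v
    simp [cylinder]
  have mem : ∀ (x : ForgetPi J) (i : ι) (K : Set (Y i)), i ∈ J x → K ∈ 𝓝 (x i) →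
      {v : ForgetPi J | i ∈ J v → v i ∈ K} ∈ 𝓝 x := fun x i K hi hK => by
    obtain ⟨U, hUK, hU, hxU⟩ := mem_nhds_iff.1 hK
    exact mem_of_superset ((isOpen_cylinder hU).mem_nhds ⟨hi, hxU⟩) fun v hv _ => hUK hv.2
  refine RegularSpace.of_lift'_closure_le fun x => ?_
  conv_rhs => rw [nhds_generateFrom]
  refine le_iInf₂ fun s hs => ?_
  obtain ⟨hxs, i, U, hU, rfl⟩ := hs
  obtain ⟨hi, hxU⟩ := hxs
  obtain ⟨K, hK, hKc, hKU⟩ := exists_mem_nhds_isClosed_subset (hU.mem_nhds hxU)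
  obtain ⟨j, hj, V, hV, h⟩ := hJ x i hi
  obtain ⟨K', hK', hKc', hKV⟩ := exists_mem_nhds_isClosed_subset hV
  rw [le_principal_iff]
  refine mem_of_superset (mem_lift' (inter_mem (mem x i K hi hK) (mem x j K' hj hK'))) ?_
  rw [((closed i K hKc).inter (closed j K' hKc')).closure_eq]
  rintro v ⟨hv, hv'⟩
  have hiv : i ∈ J v := by
    by_contra hiv
    exact (h v hiv).2 (hKV (hv' (h v hiv).1))
  exact ⟨hiv, hKU (hv hiv)⟩

end ForgetPi

/-! ### The rigid quotient of a sequence space -/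

section Rigidification

variable {Y : ℕ → Type*}

/-- A sequence remembers its `i`-th term unless the terms after it are
`b (i + 1), a (i + 2), a (i + 3), …`. -/
def remembered (a b : ∀ i, Y i) (x : ∀ i, Y i) : Set ℕ :=
  {i | ¬(x (i + 1) = b (i + 1) ∧ ∀ m > i + 1, x m = a m)}

/-- As `a` and `b` differ, the last `b` before the constant tail of `a`'s determines its position,
so no second term is forgotten. -/
theorem remembered_eq_compl_singleton {a b : ∀ i, Y i} (hab : ∀ i, a (i + 1) ≠ b (i + 1))
    {x : ∀ i, Y i} {n : ℕ} (hb : x (n + 1) = b (n + 1)) (ha : ∀ m > n + 1, x m = a m) :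
    remembered a b x = {n}ᶜ := by
  ext i
  simp only [remembered, mem_ofPred_eq, mem_compl_iff, mem_singleton_iff, not_iff_not]
  constructor
  · rintro ⟨h1, h2⟩
    rcases lt_trichotomy i n with h | h | h
    · exact absurd ((h2 (n + 1) (by omega)).symm.trans hb) (hab n)
    · exact h
    · exact absurd ((ha (i + 1) (by omega)).symm.trans h1) (hab i)
  · rintro rfl
    exact ⟨hb, ha⟩

/-- All points forgetting `i` share the same terms after `i`, and they remember those terms. A point
remembering `i` differs from this common tail somewhere. -/
theorem separates_remembered [∀ i, TopologicalSpace (Y i)] [∀ i, T1Space (Y i)]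
    {a b : ∀ i, Y i} (hab : ∀ i, a (i + 1) ≠ b (i + 1)) :
    ForgetPi.Separates (remembered a b) := by
  intro x i hi
  have hforget : ∀ v, i ∉ remembered a b v → v (i + 1) = b (i + 1) ∧ ∀ m > i + 1, v m = a m :=
    fun v hv => not_not.1 hv
  have hrem : ∀ v, i ∉ remembered a b v → ∀ j > i, j ∈ remembered a b v := fun v hv j hj hj' =>
    hab j (((hforget v hv).2 (j + 1) (by omega)).symm.trans hj'.1)
  suffices ∃ j > i, j ∈ remembered a b x ∧
      ∃ c : Y j, x j ≠ c ∧ ∀ v, i ∉ remembered a b v → v j = c by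
    obtain ⟨j, hij, hj, c, hc, h⟩ := this
    exact ⟨j, hj, {c}ᶜ, isOpen_compl_singleton.mem_nhds hc, fun v hv =>
      ⟨hrem v hv j hij, fun hv' => hv' (h v hv)⟩⟩
  have hwit : ∃ j > i, ∃ c : Y j, x j ≠ c ∧ ∀ v, i ∉ remembered a b v → v j = c := by
    by_cases h1 : x (i + 1) = b (i + 1)
    · have h2 : ∃ m > i + 1, x m ≠ a m := by
        by_contra! h2
        exact hi ⟨h1, h2⟩
      obtain ⟨m, hm, hne⟩ := h2
      exact ⟨m, by omega, a m, hne, fun v hv => (hforget v hv).2 m hm⟩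
    · exact ⟨i + 1, by omega, b (i + 1), h1, fun v hv => (hforget v hv).1⟩
  obtain ⟨j, hij, c, hc, h⟩ := hwit
  by_cases hj : j ∈ remembered a b x
  · exact ⟨j, hij, hj, c, hc, h⟩
  -- If `x` forgets the place `j` of disagreement, then `x (j + 1)` is `b` where the common tail has
  -- `a`, so `j + 1` serves instead.
  · obtain ⟨hj1, hj2⟩ := not_not.1 hj
    refine ⟨j + 1, by omega, fun hj' => ?_, a (j + 1), hj1 ▸ (hab j).symm,
      fun v hv => (hforget v hv).2 _ (by omega)⟩
    exact hab (j + 1) ((hj2 (j + 2) (by omega)).symm.trans hj'.1)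

/-- The quotient of the space of sequences in which the `i`-th term is forgotten before
`b (i + 1), a (i + 2), a (i + 3), …`. -/
abbrev Rigidification [∀ i, TopologicalSpace (Y i)] (a b : ∀ i, Y i) : Type _ :=
  SeparationQuotient (ForgetPi (remembered a b))

namespace Rigidification

variable [∀ i, TopologicalSpace (Y i)] {a b : ∀ i, Y i}

/-- The class of a sequence. -/
def mk (a b : ∀ i, Y i) (x : ∀ i, Y i) : Rigidification a b :=
  SeparationQuotient.mk (ForgetPi.ofPi (remembered a b) x)

theorem mk_surjective : Function.Surjective (mk a b) := fun q =>
  let ⟨x, hx⟩ := SeparationQuotient.surjective_mk q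
  ⟨x, hx⟩

theorem continuous_mk [∀ i, T1Space (Y i)] (hab : ∀ i, a (i + 1) ≠ b (i + 1)) :
    Continuous (mk a b) :=
  SeparationQuotient.continuous_mk.comp (ForgetPi.continuous_ofPi (separates_remembered hab))

theorem t3Space [∀ i, T3Space (Y i)] (hab : ∀ i, a (i + 1) ≠ b (i + 1)) :
    T3Space (Rigidification a b) :=
  have := ForgetPi.regularSpace (separates_remembered hab)
  inferInstance

theorem mk_update_eq (hab : ∀ i, a (i + 1) ≠ b (i + 1)) {x : ∀ i, Y i} {n : ℕ}
    (hb : x (n + 1) = b (n + 1)) (ha : ∀ m > n + 1, x m = a m) (y : Y n) :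
    mk a b x = mk a b (Function.update x n y) := by
  have h1 := remembered_eq_compl_singleton hab hb ha
  have h2 : remembered a b (Function.update x n y) = {n}ᶜ :=
    remembered_eq_compl_singleton hab (by simpa using hb)
      fun m hm => by rw [Function.update_of_ne (by omega), ha m hm]
  refine SeparationQuotient.mk_eq_mk.2 (ForgetPi.inseparable (h1.trans h2.symm) fun i hi => ?_)
  replace hi : i ∈ ({n}ᶜ : Set ℕ) := h1 ▸ hi
  exact (Function.update_of_ne (by simpa using hi) _ _).symm

theorem rRigid [∀ i, T3Space (Y i)] (hab : ∀ i, a (i + 1) ≠ b (i + 1))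
    (hY : ∀ i, ∀ g : Y (i + 1) → ℝ, Continuous g → g (a (i + 1)) = g (b (i + 1))) :
    RRigid (Rigidification a b) := by
  refine ⟨t3Space hab, fun f hf => ?_⟩
  have hF : Continuous (f ∘ mk a b) := hf.comp (continuous_mk hab)
  have step : ∀ (x : ∀ i, Y i) (n : ℕ), (∀ m ≥ n + 1, x m = a m) →
      f (mk a b x) = f (mk a b (Function.update x n (a n))) := fun x n hx => by
    have move : ∀ z : ∀ i, Y i, z (n + 1) = a (n + 1) →
        f (mk a b z) = f (mk a b (Function.update z (n + 1) (b (n + 1)))) := fun z hz => by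
      have := hY n (fun g => (f ∘ mk a b) (Function.update z (n + 1) g))
        (hF.comp (continuous_const.update (n + 1) continuous_id))
      rwa [← hz, Function.update_eq_self] at this
    -- With term `n + 1` turned into `b` on both sides, term `n` is forgotten and the two classes
    -- coincide.
    rw [move x (hx _ le_rfl), move (Function.update x n (a n)) (by simpa using hx _ le_rfl),
      mk_update_eq hab (n := n) (by simp) (fun m hm => by
        rw [Function.update_of_ne (by omega), hx m (by omega)]) (a n),
      Function.update_comm (by omega)]
  have finite : ∀ (n : ℕ) (x : ∀ i, Y i), (∀ m ≥ n, x m = a m) →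
      f (mk a b x) = f (mk a b a) := fun n => by
    induction n with
    | zero => exact fun x hx => by rw [funext fun m => hx m (Nat.zero_le m)]
    | succ n ih =>
      intro x hx
      rw [step x n hx]
      refine ih _ fun m hm => ?_
      rcases eq_or_ne m n with rfl | hne
      · simp
      · rw [Function.update_of_ne hne, hx m (by omega)]
  have all : ∀ x, f (mk a b x) = f (mk a b a) := fun x => by
    have hlim : Tendsto (fun (n m : ℕ) => if m < n then x m else a m) atTop (𝓝 x) := by
      refine tendsto_pi_nhds.2 fun m => tendsto_const_nhds.congr' ?_
      filter_upwards [eventually_gt_atTop m] with n hn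
      rw [if_pos hn]
    refine tendsto_nhds_unique ((hF.tendsto x).comp hlim) (tendsto_const_nhds.congr fun n => ?_)
    exact (finite n _ fun m hm => if_neg (by omega)).symm
  intro p q
  obtain ⟨x, rfl⟩ := mk_surjective p
  obtain ⟨y, rfl⟩ := mk_surjective q
  rw [all x, all y]

/-- The tail `a, a, …` never triggers forgetting of term `0`, so cylinders at `0` recover the
topology of `Y 0`. -/
theorem isEmbedding_mk_update [∀ i, T3Space (Y i)] (hab : ∀ i, a (i + 1) ≠ b (i + 1)) :
    IsEmbedding fun x : Y 0 => mk a b (Function.update a 0 x) := by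
  have hmem : ∀ x, 0 ∈ remembered a b (Function.update a 0 x) := fun x h =>
    hab 0 (by simpa using h.1)
  refine IsInducing.isEmbedding ⟨le_antisymm ?_ ?_⟩
  · exact ((continuous_mk hab).comp (continuous_const.update 0 continuous_id)).le_induced
  · intro U hU
    rw [isOpen_induced_iff]
    obtain ⟨V, hV, hVU⟩ := isOpen_induced_iff.1 ((SeparationQuotient.isInducing_mk
      (X := ForgetPi (remembered a b))).isOpen_iff.1
        (ForgetPi.isOpen_cylinder (J := remembered a b) hU))
    refine ⟨V, hV, ?_⟩
    ext x
    change ForgetPi.ofPi _ (Function.update a 0 x) ∈ SeparationQuotient.mk ⁻¹' V ↔ _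
    rw [hVU]
    have hx : Function.update a 0 x 0 = x := Function.update_self 0 x a
    exact ⟨fun h => hx ▸ h.2, fun h => ⟨hmem x, hx.symm ▸ h⟩⟩

end Rigidification

end Rigidification

/-! ### The corkscrew -/

/-- Copies of `P` indexed by `ℤ`, where the copies `n` and `n + 1` are to be glued along `C n`,
with one point at each end. -/
inductive Corkscrew (P : Type u) (C : ℤ → Set P) : Type u
  | pt (p : P) (n : ℤ) : Corkscrew P C
  | top : Corkscrew P C
  | bot : Corkscrew P C

namespace Corkscrew

variable {P : Type u} [TopologicalSpace P] {C : ℤ → Set P}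

/-- Gluing is imposed on open sets only: glued points are inseparable, and the separation quotient
identifies them later. -/
instance : TopologicalSpace (Corkscrew P C) where
  IsOpen U := (∀ n, IsOpen {p | pt p n ∈ U}) ∧ (∀ n, ∀ p ∈ C n, pt p n ∈ U ↔ pt p (n + 1) ∈ U) ∧
    (top ∈ U → ∀ᶠ n in atTop, ∀ p, pt p n ∈ U) ∧ (bot ∈ U → ∀ᶠ n in atBot, ∀ p, pt p n ∈ U)
  isOpen_univ := by
    refine ⟨fun n => ?_, fun n p _ => Iff.rfl, fun _ => ?_, fun _ => ?_⟩
    · exact isOpen_univ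
    · exact Eventually.of_forall fun _ _ => mem_univ _
    · exact Eventually.of_forall fun _ _ => mem_univ _
  isOpen_inter U V hU hV := by
    refine ⟨fun n => (hU.1 n).inter (hV.1 n), fun n p hp =>
      and_congr (hU.2.1 n p hp) (hV.2.1 n p hp), fun h => ?_, fun h => ?_⟩
    · filter_upwards [hU.2.2.1 h.1, hV.2.2.1 h.2] with n h1 h2 p using ⟨h1 p, h2 p⟩
    · filter_upwards [hU.2.2.2 h.1, hV.2.2.2 h.2] with n h1 h2 p using ⟨h1 p, h2 p⟩
  isOpen_sUnion S hS := by
    refine ⟨fun n => ?_, fun n p hp => ?_, ?_, ?_⟩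
    · have : {p : P | (pt p n : Corkscrew P C) ∈ ⋃₀ S} = ⋃ U ∈ S, {p | pt p n ∈ U} := by
        ext p
        simp
      rw [this]
      exact isOpen_biUnion fun U hU => (hS U hU).1 n
    · exact exists_congr fun U => and_congr_right fun hU => (hS U hU).2.1 n p hp
    · rintro ⟨U, hU, h⟩
      filter_upwards [(hS U hU).2.2.1 h] with n hn p using ⟨U, hU, hn p⟩
    · rintro ⟨U, hU, h⟩
      filter_upwards [(hS U hU).2.2.2 h] with n hn p using ⟨U, hU, hn p⟩

theorem isOpen_iff {U : Set (Corkscrew P C)} :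
    IsOpen U ↔ (∀ n, IsOpen {p | pt p n ∈ U}) ∧
      (∀ n, ∀ p ∈ C n, pt p n ∈ U ↔ pt p (n + 1) ∈ U) ∧
      (top ∈ U → ∀ᶠ n in atTop, ∀ p, pt p n ∈ U) ∧
      (bot ∈ U → ∀ᶠ n in atBot, ∀ p, pt p n ∈ U) :=
  Iff.rfl

theorem continuous_pt (n : ℤ) : Continuous fun p => (pt p n : Corkscrew P C) :=
  ⟨fun _ hU => (isOpen_iff.1 hU).1 n⟩

theorem inseparable_pt {n : ℤ} {p : P} (hp : p ∈ C n) :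
    Inseparable (pt p n : Corkscrew P C) (pt p (n + 1)) :=
  inseparable_iff_forall_isOpen.2 fun _ hU => (isOpen_iff.1 hU).2.1 n p hp

/-- The open end of the corkscrew above level `N`. -/
def upper (C : ℤ → Set P) (N : ℤ) : Set (Corkscrew P C) :=
  {x | match x with
    | pt p n => N < n ∧ (n = N + 1 → p ∉ C N)
    | top => True
    | bot => False}

/-- The open end of the corkscrew below level `N`. -/
def lower (C : ℤ → Set P) (N : ℤ) : Set (Corkscrew P C) :=
  {x | match x with
    | pt p n => n ≤ N ∧ (n = N → p ∉ C N)
    | top => False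
    | bot => True}

/-- Points of `C N` at level `N + 1` are left out because they are glued to level `N`; disjointness
of consecutive `C`'s ensures that this breaks no gluing to level `N + 2`. -/
theorem isOpen_upper (hC : ∀ n, IsClosed (C n))
    (hd : ∀ n, Disjoint (C n) (C (n + 1))) (N : ℤ) : IsOpen (upper C N) := by
  refine isOpen_iff.2 ⟨fun n => ?_, fun n p hp => ?_, fun _ => ?_, fun h => h.elim⟩
  · change IsOpen {p | N < n ∧ (n = N + 1 → p ∉ C N)}
    refine isOpen_const.and ?_
    by_cases h : n = N + 1
    · simp only [h, forall_const]
      exact (hC N).isOpen_compl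
    · simp [h]
  · change N < n ∧ (n = N + 1 → p ∉ C N) ↔ N < n + 1 ∧ (n + 1 = N + 1 → p ∉ C N)
    constructor
    · exact fun h => ⟨by omega, fun h' => by omega⟩
    · rintro ⟨h1, h2⟩
      have hne : n ≠ N := fun h => h2 (by rw [h]) (h ▸ hp)
      refine ⟨by omega, ?_⟩
      rintro rfl h3
      exact (hd N).le_bot ⟨h3, hp⟩
  · filter_upwards [eventually_gt_atTop (N + 1)] with n hn p
    exact ⟨by omega, fun h => by omega⟩

theorem isOpen_lower (hC : ∀ n, IsClosed (C n))
    (hd : ∀ n, Disjoint (C n) (C (n + 1))) (N : ℤ) : IsOpen (lower C N) := by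
  refine isOpen_iff.2 ⟨fun n => ?_, fun n p hp => ?_, fun h => h.elim, fun _ => ?_⟩
  · change IsOpen {p | n ≤ N ∧ (n = N → p ∉ C N)}
    refine isOpen_const.and ?_
    by_cases h : n = N
    · simp only [h, forall_const]
      exact (hC N).isOpen_compl
    · simp [h]
  · change n ≤ N ∧ (n = N → p ∉ C N) ↔ n + 1 ≤ N ∧ (n + 1 = N → p ∉ C N)
    constructor
    · rintro ⟨h1, h2⟩
      have hne : n ≠ N := fun h => h2 h (h ▸ hp)
      refine ⟨by omega, ?_⟩
      rintro rfl h3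
      exact (hd n).le_bot ⟨hp, h3⟩
    · exact fun h => ⟨by omega, fun h' => by omega⟩
  · filter_upwards [eventually_lt_atBot N] with n hn p
    exact ⟨by omega, fun h => by omega⟩

/-- A slab: all copies of `V` at the levels from `m` to `n`. -/
def slab (C : ℤ → Set P) (V : Set P) (m n : ℤ) : Set (Corkscrew P C) :=
  {x | match x with
    | pt p k => p ∈ V ∧ m ≤ k ∧ k ≤ n
    | top => False
    | bot => False}

theorem isOpen_slab {V : Set P} {m n : ℤ} (hV : IsOpen V) (hm : Disjoint V (C (m - 1)))
    (hn : Disjoint V (C n)) : IsOpen (slab C V m n) := by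
  refine isOpen_iff.2 ⟨fun k => ?_, fun k p hp => ?_, fun h => h.elim, fun h => h.elim⟩
  · exact hV.and isOpen_const
  · change p ∈ V ∧ m ≤ k ∧ k ≤ n ↔ p ∈ V ∧ m ≤ k + 1 ∧ k + 1 ≤ n
    refine and_congr_right fun hpV => ?_
    have h1 : k ≠ m - 1 := fun h => hm.le_bot ⟨hpV, h ▸ hp⟩
    have h2 : k ≠ n := fun h => hn.le_bot ⟨hpV, h ▸ hp⟩
    omega

theorem isClosed_slab {V : Set P} {m n : ℤ} (hV : IsClosed V) (hm : Disjoint V (C (m - 1)))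
    (hn : Disjoint V (C n)) : IsClosed (slab C V m n) := by
  rw [← isOpen_compl_iff]
  refine isOpen_iff.2 ⟨fun k => ?_, fun k p hp => ?_, fun _ => ?_, fun _ => ?_⟩
  · change IsOpen {p | ¬(p ∈ V ∧ m ≤ k ∧ k ≤ n)}
    exact (hV.and isClosed_const).isOpen_compl
  · change ¬(p ∈ V ∧ m ≤ k ∧ k ≤ n) ↔ ¬(p ∈ V ∧ m ≤ k + 1 ∧ k + 1 ≤ n)
    refine not_congr (and_congr_right fun hpV => ?_)
    have h1 : k ≠ m - 1 := fun h => hm.le_bot ⟨hpV, h ▸ hp⟩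
    have h2 : k ≠ n := fun h => hn.le_bot ⟨hpV, h ▸ hp⟩
    omega
  · filter_upwards [eventually_gt_atTop n] with k hk p h
    exact absurd h.2.2 (by omega)
  · filter_upwards [eventually_lt_atBot m] with k hk p h
    exact absurd h.2.1 (by omega)

theorem exists_isClosed_slab [RegularSpace P] {U : Set (Corkscrew P C)} (hU : IsOpen U)
    (hC : ∀ n, IsClosed (C n)) {p : P} {m n k : ℤ} (hmk : m ≤ k) (hkn : k ≤ n)
    (hp : ∀ i, m ≤ i → i ≤ n → pt p i ∈ U) (hm : p ∉ C (m - 1)) (hn : p ∉ C n) :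
    ∃ s ∈ 𝓝 (pt p k : Corkscrew P C), IsClosed s ∧ s ⊆ U := by
  have hnhds : (⋂ i ∈ Icc m n, {p' | pt p' i ∈ U}) ∩ ((C (m - 1))ᶜ ∩ (C n)ᶜ) ∈ 𝓝 p := by
    refine inter_mem ((biInter_mem (finite_Icc m n)).2 fun i hi => ?_)
      (inter_mem ((hC _).isOpen_compl.mem_nhds hm) ((hC _).isOpen_compl.mem_nhds hn))
    exact ((isOpen_iff.1 hU).1 i).mem_nhds (hp i hi.1 hi.2)
  obtain ⟨K, hK, hKc, hKs⟩ := exists_mem_nhds_isClosed_subset hnhds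
  have h1 : Disjoint K (C (m - 1)) := disjoint_left.2 fun x hx => (hKs hx).2.1
  have h2 : Disjoint K (C n) := disjoint_left.2 fun x hx => (hKs hx).2.2
  refine ⟨slab C K m n, ?_, isClosed_slab hKc h1 h2, ?_⟩
  · obtain ⟨V, hVK, hV, hpV⟩ := mem_nhds_iff.1 hK
    refine mem_of_superset ((isOpen_slab (C := C) (m := m) (n := n) hV (h1.mono_left hVK)
      (h2.mono_left hVK)).mem_nhds (show p ∈ V ∧ m ≤ k ∧ k ≤ n from ⟨hpV, hmk, hkn⟩)) ?_
    rintro (⟨p', i⟩ | _ | _) h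
    · exact ⟨hVK h.1, h.2⟩
    · exact h.elim
    · exact h.elim
  · rintro (⟨p', i⟩ | _ | _) h
    · exact mem_iInter₂.1 (hKs h.1).1 i h.2
    · exact h.elim
    · exact h.elim

/-- Disjointness lets a point be glued in at most one direction, so slabs of one or two levels
suffice. At an end, the complement of the opposite open end is a closed neighbourhood. -/
theorem regularSpace [RegularSpace P] (hC : ∀ n, IsClosed (C n))
    (hd : ∀ n, Disjoint (C n) (C (n + 1))) : RegularSpace (Corkscrew P C) := by
  refine RegularSpace.of_exists_mem_nhds_isClosed_subset fun x s hs => ?_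
  obtain ⟨U, hUs, hU, hx⟩ := mem_nhds_iff.1 hs
  suffices ∃ t ∈ 𝓝 x, IsClosed t ∧ t ⊆ U by
    obtain ⟨t, ht, htc, htU⟩ := this
    exact ⟨t, ht, htc, htU.trans hUs⟩
  have hglue := (isOpen_iff.1 hU).2.1
  rcases x with ⟨p, k⟩ | _ | _
  · by_cases h1 : p ∈ C k
    · refine exists_isClosed_slab hU hC (m := k) (n := k + 1) le_rfl (by omega) (fun i hi hi' => ?_)
        (fun h => ?_) (fun h => (hd k).le_bot ⟨h1, h⟩)
      · obtain rfl | rfl : i = k ∨ i = k + 1 := by omega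
        · exact hx
        · exact (hglue k p h1).1 hx
      · exact (hd (k - 1)).le_bot ⟨h, by simpa using h1⟩
    · by_cases h2 : p ∈ C (k - 1)
      · refine exists_isClosed_slab hU hC (m := k - 1) (n := k) (by omega) le_rfl
          (fun i hi hi' => ?_) (fun h => ?_) h1
        · obtain rfl | rfl : i = k - 1 ∨ i = k := by omega
          · exact (hglue _ p h2).2 (by simpa using hx)
          · exact hx
        · exact (hd (k - 1 - 1)).le_bot ⟨h, by simpa using h2⟩
      · refine exists_isClosed_slab hU hC le_rfl le_rfl (fun i hi hi' => ?_) h2 h1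
        obtain rfl : i = k := by omega
        exact hx
  · obtain ⟨N, hN⟩ := eventually_atTop.1 ((isOpen_iff.1 hU).2.2.1 hx)
    refine ⟨(lower C N)ᶜ, ?_, (isOpen_lower hC hd N).isClosed_compl, ?_⟩
    · refine mem_of_superset ((isOpen_upper hC hd N).mem_nhds (show top ∈ upper C N from trivial)) ?_
      rintro (⟨p', i⟩ | _ | _) h h'
      · exact absurd h.1 (not_lt.2 h'.1)
      · exact h'
      · exact h
    · rintro (⟨p', i⟩ | _ | _) h
      · refine hN i ?_ p'
        by_contra hlt
        exact h ⟨by omega, fun h => by omega⟩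
      · exact hx
      · exact absurd trivial h
  · obtain ⟨N, hN⟩ := eventually_atBot.1 ((isOpen_iff.1 hU).2.2.2 hx)
    refine ⟨(upper C (N - 1))ᶜ, ?_, (isOpen_upper hC hd _).isClosed_compl, ?_⟩
    · refine mem_of_superset ((isOpen_lower hC hd (N - 1)).mem_nhds
        (show bot ∈ lower C (N - 1) from trivial)) ?_
      rintro (⟨p', i⟩ | _ | _) h h'
      · exact absurd h'.1 (not_lt.2 h.1)
      · exact h
      · exact h'
    · rintro (⟨p', i⟩ | _ | _) h
      · refine hN i ?_ p'
        by_contra hlt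
        exact h ⟨by omega, fun h => by omega⟩
      · exact absurd trivial h
      · exact hx

theorem not_inseparable_top_bot (hC : ∀ n, IsClosed (C n))
    (hd : ∀ n, Disjoint (C n) (C (n + 1))) :
    ¬Inseparable (top : Corkscrew P C) bot := fun h =>
  (inseparable_iff_forall_isOpen.1 h _ (isOpen_upper hC hd 0)).1 (show top ∈ upper C 0 from trivial)

theorem separableSpace [SeparableSpace P] [Nonempty P] : SeparableSpace (Corkscrew P C) := by
  obtain ⟨D, hDc, hD⟩ := exists_countable_dense P
  refine ⟨⟨(fun x : P × ℤ => pt x.1 x.2) '' (D ×ˢ univ),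
    (hDc.prod (countable_univ (α := ℤ))).image _, ?_⟩⟩
  have key : ∀ U : Set (Corkscrew P C), IsOpen U → ∀ n, (∃ p, pt p n ∈ U) →
      (U ∩ (fun x : P × ℤ => pt x.1 x.2) '' (D ×ˢ univ)).Nonempty := by
    rintro U hU n ⟨p, hp⟩
    obtain ⟨d, hdU, hdD⟩ := hD.inter_open_nonempty _ ((isOpen_iff.1 hU).1 n) ⟨p, hp⟩
    exact ⟨pt d n, hdU, (d, n), ⟨hdD, mem_univ _⟩, rfl⟩
  refine dense_iff_inter_open.2 fun U hU hne => ?_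
  obtain ⟨x, hx⟩ := hne
  obtain ⟨p₀⟩ := ‹Nonempty P›
  rcases x with ⟨p, n⟩ | _ | _
  · exact key U hU n ⟨p, hx⟩
  · obtain ⟨n, hn⟩ := ((isOpen_iff.1 hU).2.2.1 hx).exists
    exact key U hU n ⟨p₀, hn p₀⟩
  · obtain ⟨n, hn⟩ := ((isOpen_iff.1 hU).2.2.2 hx).exists
    exact key U hU n ⟨p₀, hn p₀⟩

/-- A sequence either visits one level infinitely often or has a subsequence converging to an end.
-/
theorem subseqCompact (hP : SubseqCompact P) : SubseqCompact (Corkscrew P C) := by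
  intro t
  by_cases hlev : ∃ n, ∃ᶠ k in atTop, ∃ p, t k = pt p n
  · obtain ⟨n, hn⟩ := hlev
    obtain ⟨φ, hφ, h⟩ := extraction_of_frequently_atTop hn
    choose p hp using h
    obtain ⟨ψ, hψ, K, hK, hmem⟩ := hP p
    exact ⟨φ ∘ ψ, hφ.comp hψ, (fun p => pt p n) '' K, hK.image (continuous_pt n),
      fun i => ⟨_, hmem i, (hp _).symm⟩⟩
  · simp only [not_exists, not_frequently] at hlev
    have hfin : ∀ s : Set ℤ, s.Finite → ∀ᶠ k in atTop, ∀ n ∈ s, ∀ p, t k ≠ pt p n :=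
      fun s hs => (eventually_all_finite hs).2 fun n _ => hlev n
    have compact_of_tendsto : ∀ (φ : ℕ → ℕ) (x : Corkscrew P C), StrictMono φ →
        Tendsto (t ∘ φ) atTop (𝓝 x) → ∃ φ : ℕ → ℕ, StrictMono φ ∧
          ∃ K : Set (Corkscrew P C), IsCompact K ∧ ∀ n, t (φ n) ∈ K := fun φ x hφ hx =>
      ⟨φ, hφ, _, hx.isCompact_insert_range, fun n => Or.inr ⟨n, rfl⟩⟩
    have hor : (∃ᶠ k in atTop, t k = top ∨ ∃ n ≥ 0, ∃ p, t k = pt p n) ∨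
        ∃ᶠ k in atTop, t k = bot ∨ ∃ n < 0, ∃ p, t k = pt p n := by
      rw [← frequently_or_distrib]
      refine Frequently.of_forall fun k => ?_
      rcases t k with ⟨p, n⟩ | _ | _
      · rcases lt_or_ge n 0 with h | h
        · exact Or.inr (Or.inr ⟨n, h, p, rfl⟩)
        · exact Or.inl (Or.inr ⟨n, h, p, rfl⟩)
      · exact Or.inl (Or.inl rfl)
      · exact Or.inr (Or.inl rfl)
    rcases hor with h | h
    · obtain ⟨φ, hφ, h⟩ := extraction_of_frequently_atTop h
      refine compact_of_tendsto φ top hφ (tendsto_nhds.2 fun U hU hx => ?_)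
      obtain ⟨N, hN⟩ := eventually_atTop.1 ((isOpen_iff.1 hU).2.2.1 hx)
      filter_upwards [hφ.tendsto_atTop.eventually (hfin _ (finite_Icc 0 N))] with k hk
      change t (φ k) ∈ U
      rcases h k with h' | ⟨n, hn, p, h'⟩
      · rwa [h']
      · rw [h']
        refine hN n ?_ p
        by_contra hlt
        exact hk n ⟨hn, by omega⟩ p h'
    · obtain ⟨φ, hφ, h⟩ := extraction_of_frequently_atTop h
      refine compact_of_tendsto φ bot hφ (tendsto_nhds.2 fun U hU hx => ?_)
      obtain ⟨N, hN⟩ := eventually_atBot.1 ((isOpen_iff.1 hU).2.2.2 hx)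
      filter_upwards [hφ.tendsto_atTop.eventually (hfin _ (finite_Icc N 0))] with k hk
      change t (φ k) ∈ U
      rcases h k with h' | ⟨n, hn, p, h'⟩
      · rwa [h']
      · rw [h']
        refine hN n ?_ p
        by_contra hlt
        exact hk n ⟨by omega, hn.le⟩ p h'

/-- If every continuous function on `P` converges along a filter that meets all the sets `C n`,
then the two ends of the corkscrew cannot be told apart by continuous functions. -/
theorem apply_top_eq_apply_bot {l : Filter P} (hl : ∀ n, (l ⊓ 𝓟 (C n)).NeBot)
    (hlim : ∀ g : P → ℝ, Continuous g → ∃ c : EReal, Tendsto (fun p => (g p : EReal)) l (𝓝 c))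
    {f : Corkscrew P C → ℝ} (hf : Continuous f) : f top = f bot := by
  choose c hc using fun n => hlim (fun p => f (pt p n)) (hf.comp (continuous_pt n))
  have : l.NeBot := (hl 0).mono inf_le_left
  have hstep : ∀ n, c (n + 1) = c n := fun n => by
    have := hl n
    refine tendsto_nhds_unique ((hc (n + 1)).mono_left (inf_le_left (b := 𝓟 (C n))))
      (((hc n).mono_left inf_le_left).congr' ?_)
    filter_upwards [mem_inf_of_right (mem_principal_self (C n))] with p hp
    rw [((inseparable_pt hp).map hf).eq]
  have hconst : ∀ n, c n = c 0 := fun n => by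
    induction n using Int.induction_on with
    | zero => rfl
    | succ n ih => rw [hstep, ih]
    | pred n ih => rw [← ih, ← hstep (-n - 1), sub_add_cancel]
  -- A neighbourhood of an end contains whole levels, so a closed neighbourhood of the value there
  -- contains their common limit `c 0`.
  have hend : ∀ (x : Corkscrew P C) (F : Filter ℤ) [F.NeBot],
      (∀ U : Set (Corkscrew P C), IsOpen U → x ∈ U → ∀ᶠ n in F, ∀ p, pt p n ∈ U) →
      (f x : EReal) = c 0 := fun x F _ hx => by
    by_contra hne
    obtain ⟨K, hK, hKc, hKs⟩ :=
      exists_mem_nhds_isClosed_subset (isOpen_compl_singleton.mem_nhds hne)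
    obtain ⟨W, hWK, hW, hxW⟩ := mem_nhds_iff.1 hK
    obtain ⟨n, hn⟩ := (hx _ (hW.preimage (continuous_coe_real_ereal.comp hf)) hxW).exists
    have : c n ∈ K := hKc.mem_of_tendsto (hc n) (Eventually.of_forall fun p => hWK (hn p))
    rw [hconst n] at this
    exact hKs this rfl
  exact EReal.coe_injective ((hend top atTop fun U hU h => (isOpen_iff.1 hU).2.2.1 h).trans
    (hend bot atBot fun U hU h => (isOpen_iff.1 hU).2.2.2 h).symm)

end Corkscrew

/-! ### Ultrafilters and the plank -/

/-- A sequence of ultrafilters different from `q` does not converge to `q`. -/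
theorem Ultrafilter.exists_notMem_frequently_mem {β : Type*} {t : ℕ → Ultrafilter β}
    {q : Ultrafilter β} (ht : ∀ n, t n ≠ q) : ∃ S ∉ q, ∃ᶠ n in atTop, S ∈ t n := by
  by_contra! hcon
  have hnext : ∀ (U : {U : Set β // U ∉ q}) (N : ℕ),
      ∃ n ≥ N, ∃ S ∈ t n, S ∉ q ∧ Disjoint S U := fun U N => by
    obtain ⟨n, hnU, hnN⟩ := ((hcon U U.2).and (eventually_ge_atTop N)).exists
    obtain ⟨S, hS, hSq⟩ : ∃ S ∈ t n, S ∉ q := by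
      by_contra! h
      exact ht n (Ultrafilter.coe_le_coe.1 h).symm
    exact ⟨n, hnN, S \ U, (t n).sdiff_mem_iff.2 ⟨hS, hnU⟩,
      fun h => hSq (mem_of_superset h sdiff_subset), disjoint_sdiff_left⟩
  choose ν hν S hSt hSq hSU using hnext
  -- The state holds the union of the sets chosen so far, still outside `q`, and a lower bound for
  -- the next index.
  let st : ℕ → {U : Set β // U ∉ q} × ℕ := fun k =>
    Nat.rec (⟨∅, q.empty_notMem⟩, 0) (fun _ p => (⟨p.1 ∪ S p.1 p.2,
      fun h => (Ultrafilter.union_mem_iff.1 h).elim p.1.2 (hSq p.1 p.2)⟩, ν p.1 p.2 + 1)) k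
  let T : ℕ → Set β := fun k => S (st k).1 (st k).2
  let m : ℕ → ℕ := fun k => ν (st k).1 (st k).2
  have hm : StrictMono m := strictMono_nat_of_lt_succ fun k => hν (st (k + 1)).1 (st (k + 1)).2
  have hTm : ∀ k, T k ∈ t (m k) := fun k => hSt _ _
  have hmono : Monotone fun k => ((st k).1 : Set β) :=
    monotone_nat_of_le_succ fun k => subset_union_left
  have hTsub : ∀ j k, j < k → T j ⊆ (st k).1 := fun j k hjk =>
    (subset_union_right : T j ⊆ (st (j + 1)).1).trans (hmono hjk)
  have hdisj : ∀ j k, j ≠ k → Disjoint (T j) (T k) := fun j k hjk => by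
    rcases hjk.lt_or_gt with h | h
    · exact ((hSU _ _).mono_right (hTsub j k h)).symm
    · exact (hSU _ _).mono_right (hTsub k j h)
  -- Each such union lies in infinitely many `t n`, hence in `q`; but the even and the odd unions
  -- are disjoint.
  have hmem : ∀ r : ℕ, ⋃ k, T (2 * k + r) ∈ q := fun r => by
    by_contra hr
    obtain ⟨N, hN⟩ := eventually_atTop.1 (hcon _ hr)
    have hle : N ≤ m (2 * N + r) := le_trans (by omega) hm.le_apply
    exact hN _ hle (mem_of_superset (hTm (2 * N + r)) (subset_iUnion (fun k => T (2 * k + r)) N))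
  refine q.empty_notMem (mem_of_superset (inter_mem (hmem 0) (hmem 1)) ?_)
  rintro x ⟨h0, h1⟩
  obtain ⟨j, hj⟩ := mem_iUnion.1 h0
  obtain ⟨k, hk⟩ := mem_iUnion.1 h1
  exact (hdisj (2 * j + 0) (2 * k + 1) (by omega)).le_bot ⟨hj, hk⟩

theorem Ultrafilter.continuous_of_isOpen_mem {X β : Type*} [TopologicalSpace X]
    {g : X → Ultrafilter β} (h : ∀ S : Set β, IsOpen {x | S ∈ g x}) : Continuous g := by
  refine ultrafilterBasis_is_basis.continuous_iff.2 ?_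
  rintro _ ⟨S, rfl⟩
  exact h S

theorem Ultrafilter.continuous_map {β γ : Type*} (g : β → γ) : Continuous (Ultrafilter.map g) :=
  Ultrafilter.continuous_of_isOpen_mem fun _ => ultrafilter_isOpen_basic _

namespace Plank

variable (α : Type u) [Infinite α]

/-- The sum over `u` of copies of the hyperfilter in the columns of `α × α`. -/
noncomputable def columnSum (u : Ultrafilter α) : Ultrafilter (α × α) :=
  u.bind fun n => (hyperfilter α).map (Prod.mk n)

variable {α}

theorem mem_columnSum {u : Ultrafilter α} {S : Set (α × α)} :
    S ∈ columnSum α u ↔ {n | {m | (n, m) ∈ S} ∈ hyperfilter α} ∈ u :=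
  Iff.rfl

theorem continuous_columnSum : Continuous (columnSum α) :=
  Ultrafilter.continuous_of_isOpen_mem fun _ => ultrafilter_isOpen_basic _

theorem map_fst_columnSum (u : Ultrafilter α) : (columnSum α u).map Prod.fst = u := by
  ext S
  rw [Ultrafilter.mem_map, mem_columnSum]
  have : {n | {m : α | (n, m) ∈ Prod.fst ⁻¹' S} ∈ hyperfilter α} = S := by
    ext n
    by_cases hn : n ∈ S
    · simp only [mem_preimage, hn, ofPred_true, mem_ofPred_eq, iff_true]
      exact univ_mem (f := (hyperfilter α : Filter α))
    · simp [hn]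
  rw [this]

theorem pure_ne_hyperfilter (n : α) : pure n ≠ hyperfilter α := fun h => by
  have : ({n} : Set α) ∈ hyperfilter α := h ▸ Ultrafilter.mem_pure.2 rfl
  exact (finite_singleton n).notMem_hyperfilter this

variable (α)

/-- The point removed from the space of ultrafilters on `α × α`. -/
noncomputable def corner : Ultrafilter (α × α) := columnSum α (hyperfilter α)

/-- The space of ultrafilters on `α × α` without `corner α`. -/
abbrev _root_.Plank : Type u := {x : Ultrafilter (α × α) // x ≠ corner α}

/-- The sums of hyperfilters on columns. -/
def edge : Set (Plank α) := Subtype.val ⁻¹' range (columnSum α)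

/-- The ultrafilters that project to the hyperfilter. -/
def side : Set (Plank α) := Subtype.val ⁻¹' (Ultrafilter.map Prod.fst ⁻¹' {hyperfilter α})

/-- The trace of the neighbourhoods of `corner α`. -/
noncomputable def atCorner : Filter (Plank α) := comap Subtype.val (𝓝 (corner α))

variable {α}

theorem isClosed_edge : IsClosed (edge α) :=
  (isCompact_range continuous_columnSum).isClosed.preimage continuous_subtype_val

theorem isClosed_side : IsClosed (side α) :=
  (isClosed_singleton.preimage (Ultrafilter.continuous_map _)).preimage continuous_subtype_val

/-- The first projection recovers `u` from `columnSum α u`, so the only possible common point is the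
removed corner. -/
theorem disjoint_edge_side : Disjoint (edge α) (side α) := by
  refine disjoint_left.2 ?_
  rintro ⟨x, hx⟩ ⟨u, hu⟩ h
  change columnSum α u = x at hu
  change x.map Prod.fst = hyperfilter α at h
  rw [← hu, map_fst_columnSum] at h
  exact hx (by rw [← hu, h, corner])

theorem atCorner_inf_principal_neBot {A : Set (Plank α)}
    (h : ∀ S ∈ corner α, ∃ p ∈ A, S ∈ (p : Ultrafilter (α × α))) :
    (atCorner α ⊓ 𝓟 A).NeBot := by
  refine inf_principal_neBot_iff.2 fun U hU => ?_
  obtain ⟨V, hV, hVU⟩ := mem_comap.1 hU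
  obtain ⟨_, ⟨S, rfl⟩, hS, hSV⟩ := ultrafilterBasis_is_basis.mem_nhds_iff.1 hV
  obtain ⟨p, hpA, hp⟩ := h S hS
  exact ⟨p, hVU (hSV hp), hpA⟩

theorem atCorner_inf_edge_neBot : (atCorner α ⊓ 𝓟 (edge α)).NeBot := by
  refine atCorner_inf_principal_neBot fun S hS => ?_
  obtain ⟨n, hn⟩ := Ultrafilter.nonempty_of_mem (mem_columnSum.1 hS)
  refine ⟨⟨columnSum α (pure n), fun h => pure_ne_hyperfilter n ?_⟩, ⟨_, rfl⟩,
    mem_columnSum.2 (Ultrafilter.mem_pure.2 hn)⟩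
  rw [← map_fst_columnSum (pure n), h, corner, map_fst_columnSum]

/-- Push the hyperfilter onto a graph running inside `S`. A graph meets each column in one point, so
it is not in the corner. -/
theorem atCorner_inf_side_neBot : (atCorner α ⊓ 𝓟 (side α)).NeBot := by
  refine atCorner_inf_principal_neBot fun S hS => ?_
  have hsec : ∀ n, ∃ m, {m | (n, m) ∈ S} ∈ hyperfilter α → (n, m) ∈ S := fun n => by
    by_cases h : {m | (n, m) ∈ S} ∈ hyperfilter α
    · obtain ⟨m, hm⟩ := Ultrafilter.nonempty_of_mem h
      exact ⟨m, fun _ => hm⟩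
    · exact ⟨n, fun h' => absurd h' h⟩
  choose g hg using hsec
  refine ⟨⟨(hyperfilter α).map fun n => (n, g n), fun h => ?_⟩, ?_, ?_⟩
  · have hgraph : range (fun n => (n, g n)) ∈ corner α := by
      rw [← h, Ultrafilter.mem_map]
      exact univ_mem' fun n => ⟨n, rfl⟩
    obtain ⟨n, hn⟩ := Ultrafilter.nonempty_of_mem (mem_columnSum.1 hgraph)
    refine (finite_singleton (g n)).notMem_hyperfilter (mem_of_superset hn ?_)
    rintro m ⟨n', hn'⟩
    obtain ⟨rfl, rfl⟩ := Prod.ext_iff.1 hn'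
    rfl
  · change ((hyperfilter α).map fun n => (n, g n)).map Prod.fst = hyperfilter α
    rw [Ultrafilter.map_map]
    exact Ultrafilter.map_id _
  · exact Ultrafilter.mem_map.2 (mem_of_superset (mem_columnSum.1 hS) fun n hn => hg n hn)

theorem pure_ne_corner (x : α × α) : pure x ≠ corner α := fun h =>
  pure_ne_hyperfilter x.1 (by
    rw [← map_fst_columnSum (hyperfilter α), ← corner, ← h, Ultrafilter.map_pure])

theorem denseRange_pure : DenseRange fun x : α × α => (⟨pure x, pure_ne_corner x⟩ : Plank α) := by
  refine dense_iff_inter_open.2 fun U hU hne => ?_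
  obtain ⟨V, hV, rfl⟩ := isOpen_induced_iff.1 hU
  obtain ⟨p, hp⟩ := hne
  obtain ⟨_, hx, x, rfl⟩ := (_root_.denseRange_pure (α := α × α)).inter_open_nonempty V hV ⟨p, hp⟩
  exact ⟨⟨pure x, pure_ne_corner x⟩, hx, x, rfl⟩

theorem separableSpace [Countable α] : SeparableSpace (Plank α) :=
  ⟨⟨_, countable_range _, denseRange_pure⟩⟩

/-- The values on principal ultrafilters extend to all ultrafilters because `EReal` is compact;
density makes the extension agree with `g`. -/
theorem exists_tendsto_atCorner {g : Plank α → ℝ} (hg : Continuous g) :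
    ∃ c : EReal, Tendsto (fun p => (g p : EReal)) (atCorner α) (𝓝 c) := by
  let F : Ultrafilter (α × α) → EReal :=
    Ultrafilter.extend fun x => (g ⟨pure x, pure_ne_corner x⟩ : EReal)
  have hF : Continuous F := continuous_ultrafilter_extend _
  have heq : (fun p => (g p : EReal)) = F ∘ Subtype.val :=
    denseRange_pure.equalizer (continuous_coe_real_ereal.comp hg)
      (hF.comp continuous_subtype_val) (funext fun x => (ultrafilter_extend_pure _ x).symm)
  rw [heq]
  exact ⟨_, (hF.tendsto (corner α)).comp tendsto_comap⟩

/-- For `S` outside the corner, the ultrafilters containing `S` form a compact set avoiding it, and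
some such set catches a subsequence. -/
theorem subseqCompact : SubseqCompact (Plank α) := by
  intro t
  obtain ⟨S, hS, hfreq⟩ := Ultrafilter.exists_notMem_frequently_mem
    (t := fun n => (t n : Ultrafilter (α × α))) fun n => (t n).2
  obtain ⟨φ, hφ, h⟩ := extraction_of_frequently_atTop hfreq
  refine ⟨φ, hφ, Subtype.val ⁻¹' {x | S ∈ x}, ?_, h⟩
  rw [Subtype.isCompact_iff, image_preimage_eq_of_subset]
  · exact (ultrafilter_isClosed_basic S).isCompact
  · intro x hx
    exact ⟨⟨x, fun h => hS (h ▸ hx)⟩, rfl⟩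

end Plank

/-! ### Assembling the examples -/

/-- A regular separable space that is totally countably compact and has two points that are not
separated by continuous real functions. -/
theorem exists_unseparated_pair : ∃ (Z : Type u) (_ : TopologicalSpace Z) (a b : Z),
    T3Space Z ∧ SeparableSpace Z ∧ SubseqCompact Z ∧ a ≠ b ∧
      ∀ g : Z → ℝ, Continuous g → g a = g b := by
  let α := ULift.{u} ℕ
  let C : ℤ → Set (Plank α) := fun n => if Even n then Plank.edge α else Plank.side α
  have hE : ∀ n, Even n → C n = Plank.edge α := fun n h => if_pos h
  have hO : ∀ n, ¬Even n → C n = Plank.side α := fun n h => if_neg h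
  have hC : ∀ n, IsClosed (C n) := fun n => by
    by_cases h : Even n
    · exact hE n h ▸ Plank.isClosed_edge
    · exact hO n h ▸ Plank.isClosed_side
  have hd : ∀ n, Disjoint (C n) (C (n + 1)) := fun n => by
    by_cases h : Even n
    · rw [hE n h, hO (n + 1) fun h' => Int.even_add_one.1 h' h]
      exact Plank.disjoint_edge_side
    · rw [hO n h, hE (n + 1) (Int.even_add_one.2 h)]
      exact Plank.disjoint_edge_side.symm
  have hl : ∀ n, (Plank.atCorner α ⊓ 𝓟 (C n)).NeBot := fun n => by
    by_cases h : Even n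
    · exact hE n h ▸ Plank.atCorner_inf_edge_neBot
    · exact hO n h ▸ Plank.atCorner_inf_side_neBot
  have := Corkscrew.regularSpace hC hd
  have : SeparableSpace (Plank α) := Plank.separableSpace
  have : Nonempty (Plank α) := ⟨⟨pure (⟨0⟩, ⟨0⟩), Plank.pure_ne_corner _⟩⟩
  have : SeparableSpace (Corkscrew (Plank α) C) := Corkscrew.separableSpace
  refine ⟨SeparationQuotient (Corkscrew (Plank α) C), inferInstance,
    SeparationQuotient.mk .top, SeparationQuotient.mk .bot, inferInstance,
    SeparationQuotient.surjective_mk.denseRange.separableSpace SeparationQuotient.continuous_mk,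
    (Corkscrew.subseqCompact Plank.subseqCompact).of_surjective SeparationQuotient.continuous_mk
      SeparationQuotient.surjective_mk, ?_, fun g hg => ?_⟩
  · exact fun h => Corkscrew.not_inseparable_top_bot hC hd (SeparationQuotient.mk_eq_mk.1 h)
  · exact Corkscrew.apply_top_eq_apply_bot hl (fun _ h => Plank.exists_tendsto_atCorner h)
      (hg.comp SeparationQuotient.continuous_mk)

/-- The sequence of spaces `X, Z, Z, Z, …`. -/
def ConsType (X Z : Type u) : ℕ → Type u
  | 0 => X
  | _ + 1 => Z

instance (X Z : Type u) [TopologicalSpace X] [TopologicalSpace Z] :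
    ∀ i, TopologicalSpace (ConsType X Z i)
  | 0 => ‹TopologicalSpace X›
  | _ + 1 => ‹TopologicalSpace Z›

/-- The sequence `x, z, z, z, …`. -/
def ConsType.cons {X Z : Type u} (x : X) (z : Z) : ∀ i, ConsType X Z i
  | 0 => x
  | _ + 1 => z

/-- Only the terms after the first need an unseparated pair, so `X` can occupy position `0`. As the
other factors are `SubseqCompact`, mere countable compactness of `X` passes to the product. -/
theorem exists_rRigid_extension (X : Type u) [TopologicalSpace X] [SeparableSpace X] [T3Space X]
    [Nonempty X] : ∃ (R : Type u) (_ : TopologicalSpace R),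
      T3Space R ∧ SeparableSpace R ∧ RRigid R ∧ (∃ e : X → R, IsEmbedding e) ∧
      (CountablyCompactSpace X → CountablyCompactSpace R) ∧
      (TotallyCountablyCompact X → TotallyCountablyCompact R) := by
  obtain ⟨Z, _, a, b, hZ3, hZs, hZc, hne, hab⟩ := exists_unseparated_pair.{u}
  obtain ⟨x⟩ := ‹Nonempty X›
  have : ∀ i, T3Space (ConsType X Z i)
    | 0 => ‹T3Space X›
    | _ + 1 => hZ3
  have : ∀ i, SeparableSpace (ConsType X Z i)
    | 0 => ‹SeparableSpace X›
    | _ + 1 => hZs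
  have hne' : ∀ i, ConsType.cons x a (i + 1) ≠ ConsType.cons x b (i + 1) := fun _ => hne
  have hcont := Rigidification.continuous_mk hne'
  have hsurj := Rigidification.mk_surjective (a := ConsType.cons x a) (b := ConsType.cons x b)
  have hT3 := Rigidification.t3Space hne'
  refine ⟨Rigidification (ConsType.cons x a) (ConsType.cons x b), inferInstance, hT3,
    hsurj.denseRange.separableSpace hcont, Rigidification.rRigid hne' fun _ => hab,
    ⟨_, Rigidification.isEmbedding_mk_update hne'⟩, fun hX => ?_, fun hX => ?_⟩
  · have : CountablyCompactSpace (ConsType X Z 0) := hX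
    have := CountablyCompactSpace.pi_nat (Y := ConsType X Z) fun _ => hZc
    exact .of_surjective hcont hsurj
  · have : ∀ i, SubseqCompact (ConsType X Z i)
      | 0 => hX.subseqCompact
      | _ + 1 => hZc
    exact ((SubseqCompact.pi this).of_surjective hcont hsurj).totallyCountablyCompact

theorem nonempty_of_not_normalSpace {X : Type*} [TopologicalSpace X] (h : ¬NormalSpace X) :
    Nonempty X := by
  by_contra hX
  have := not_nonempty_iff.1 hX
  exact h inferInstance

end

theorem theorem3p4 :
    -- the countably compact version
    (∀ (X : Type u) [TopologicalSpace X],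
      TopologicalSpace.SeparableSpace X → T3Space X → ¬ NormalSpace X →
      CountablyCompactSpace X →
      ∃ (R : Type u) (_ : TopologicalSpace R),
        T3Space R ∧ TopologicalSpace.SeparableSpace R ∧ CountablyCompactSpace R ∧ RRigid R ∧
        ∃ e : X → R, Topology.IsEmbedding e) ∧
    -- the totally countably compact version
    (∀ (X : Type u) [TopologicalSpace X],
      TopologicalSpace.SeparableSpace X → T3Space X → ¬ NormalSpace X →
      TotallyCountablyCompact X →
      ∃ (R : Type u) (_ : TopologicalSpace R),
        T3Space R ∧ TopologicalSpace.SeparableSpace R ∧ TotallyCountablyCompact R ∧ RRigid R ∧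
        ∃ e : X → R, Topology.IsEmbedding e) ∧
    -- the resulting example, with no hypotheses
    (∃ (R : Type) (_ : TopologicalSpace R),
      Nontrivial R ∧ T3Space R ∧ TopologicalSpace.SeparableSpace R ∧
      CountablyCompactSpace R ∧ TotallyCountablyCompact R ∧ RRigid R) := by
  refine ⟨fun X _ hs h3 hn hc => ?_, fun X _ hs h3 hn hc => ?_, ?_⟩
  · have := nonempty_of_not_normalSpace hn
    obtain ⟨R, tR, hR3, hRs, hRr, hRe, hRc, -⟩ := exists_rRigid_extension X
    exact ⟨R, tR, hR3, hRs, hRc hc, hRr, hRe⟩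
  · have := nonempty_of_not_normalSpace hn
    obtain ⟨R, tR, hR3, hRs, hRr, hRe, -, hRc⟩ := exists_rRigid_extension X
    exact ⟨R, tR, hR3, hRs, hRc hc, hRr, hRe⟩
  · obtain ⟨Z, _, a, b, hZ3, hZs, hZc, hne, -⟩ := exists_unseparated_pair.{0}
    have : Nonempty Z := ⟨a⟩
    obtain ⟨R, tR, hR3, hRs, hRr, ⟨e, he⟩, hRc, hRt⟩ := exists_rRigid_extension Z
    exact ⟨R, tR, ⟨e a, e b, he.injective.ne hne⟩, hR3, hRs, hRc hZc.countablyCompactSpace,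
      hRt hZc.totallyCountablyCompact, hRr⟩
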